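/- Let $d\ge 1$ and let $\mathcal T_h$ be a finite conforming simplicial mesh in $\mathbb R^d$ (every simplex is a face of a $d$-simplex). Let $\Omega$, the interior of the union of its elements $K$, be the triangulated polytope, with set of nodes $\mathcal N_h$. A set of facets of $\mathcal T_h$ on $\partial\Omega$ ("edges" if $d=2$) is designated as Neumann facets; their union is $\Gamma_{\mathrm N}$, and the union of the other boundary facets is $\Gamma_{\mathrm D}$. Let $\mathcal A$ (symmetric positive definite) and $c,\beta_1\ge 0$ be constant on each element, let $\alpha,\beta_2\ge0$ be constant on each Neumann facet, let $\beta_1$ or $\beta_2$ be positive somewhere, and let $\gamma>0$. Let $\Omega_0$ consist of the elements where $c=\beta_1=0$, $\Omega_+=\Omega\setminus\Omega_0$; let $\Gamma_{\mathrm N0}$ consist of the Neumann facets where $\alpha=\beta_2=0$, and $\Gamma_{\mathrm N+}$ of the other Neumann facets. Let $V=\{v\in H^1(\Omega): v=0\text{ on }\Gamma_{\mathrm D}\}$, $V_h=\{v\in V: v|_K\in P_1(K)\ \forall K\in\mathcal T_h\}$, $$a(u,v)=(\mathcal A\nabla u,\nabla v)+([c+\gamma\beta_1]u,v)+([\alpha+\gamma\beta_2]u,v)_{\Gamma_{\mathrm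 N}},\qquad b(u,v)=(\beta_1u,v)+(\beta_2u,v)_{\Gamma_{\mathrm N}},$$ and let $\Lambda\in\mathbb R$, $u_h\in V_h\setminus\{0\}$ satisfy $a(u_h,v_h)=(\Lambda+\gamma)\,b(u_h,v_h)$ for all $v_h\in V_h$. For $z\in\mathcal N_h$ let $\psi_z$ be the hat function of $z$ (continuous, piecewise affine, $1$ at $z$ and $0$ at the other nodes), $\mathcal T_z$ the set of elements containing $z$, $\omega_z$ the interior of their union, with outward unit normal $n_z$. Let $\Gamma^{\mathrm E}_z$ be the union of the facets on $\partial\omega_z$ not containing $z$, and $\Gamma^{\mathrm N0}_z$, $\Gamma^{\mathrm N+}_z$ the unions of the facets in $\Gamma_{\mathrm N0}$, respectively $\Gamma_{\mathrm N+}$, that lie on $\partial\omega_z$ and contain $z$. With $\mathbf{RT}_1(K)=[P_1(K)]^d+x\,P_1(K)$, let $$\widetilde W_h=\{\sigma\in H(\mathrm{div},\Omega):\ \sigma|_K\in\mathbf{RT}_1(K)\ \forall K\in\mathcal T_h,\ \sigma\cdot n_\Omega=0\text{ on }\Gamma_{\mathrm N0}\},$$ $$\widetilde W_z=\{w\in H(\mathrm{div},\omega_z):\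 w|_K\in\mathbf{RT}_1(K)\ \forall K\in\mathcal T_z,\ w\cdot n_z=0\text{ on }\Gamma^{\mathrm E}_z\cup\Gamma^{\mathrm N0}_z\},$$ $$\widetilde Q_z=\{q\in L^2(\omega_z\cap\Omega_0):\ q|_K\in P_1(K)\ \forall K\in\mathcal T_z,\ K\subset\overline{\Omega}_0\}.$$ For every $z\in\mathcal N_h$ let $(\sigma_z,q_z)\in\widetilde W_z\times\widetilde Q_z$ satisfy $$\begin{aligned} &(\mathcal A^{-1}\sigma_z,w)_{\omega_z}+\Big(\tfrac{\operatorname{div}\sigma_z}{c+\gamma\beta_1},\operatorname{div}w\Big)_{\omega_z\cap\Omega_+}+\Big(\tfrac{\sigma_z\cdot n_\Omega}{\alpha+\gamma\beta_2},w\cdot n_\Omega\Big)_{\Gamma^{\mathrm N+}_z}+(q_z,\operatorname{div}w)_{\omega_z\cap\Omega_0}\\ &=\Big(\psi_z\tfrac{\nabla u_h}{\Lambda+\gamma},w\Big)_{\omega_z}-\Big(\tfrac{(\Lambda\beta_1-c)\psi_zu_h}{(c+\gamma\beta_1)(\Lambda+\gamma)},\operatorname{div}w\Big)_{\omega_z\cap\Omega_+}+\Big(\tfrac{(\mathcal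 A\nabla\psi_z)\cdot\nabla u_h}{(c+\gamma\beta_1)(\Lambda+\gamma)},\operatorname{div}w\Big)_{\omega_z\cap\Omega_+}\\ &\quad+\Big(\tfrac{(\Lambda\beta_2-\alpha)\psi_zu_h}{(\alpha+\gamma\beta_2)(\Lambda+\gamma)},w\cdot n_\Omega\Big)_{\Gamma^{\mathrm N+}_z}\qquad\forall w\in\widetilde W_z,\\ &(\operatorname{div}\sigma_z,\varphi)_{\omega_z\cap\Omega_0}=\Big(\tfrac{(\mathcal A\nabla\psi_z)\cdot\nabla u_h}{\Lambda+\gamma},\varphi\Big)_{\omega_z\cap\Omega_0}\qquad\forall\varphi\in\widetilde Q_z . \end{aligned}$$ Let $\sigma_h=\sum_{z\in\mathcal N_h}\sigma_z$, each $\sigma_z$ extended by zero outside $\omega_z$. Then $\sigma_h\in\widetilde W_h$, and the pair $(u_h,\sigma_h)$ satisfies the hypotheses of the (generalized) Lehmann–Goerisch theorem on $(\tilde u,\tilde\sigma)$: $$u_h\in V,\quad \sigma_h\in H(\mathrm{div},\Omega),\quad \beta_1u_h+\operatorname{div}\sigma_h=0\ \text{in }\Omega_0,\quad \beta_2u_h-\sigma_h\cdot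 n_\Omega=0\ \text{on }\Gamma_{\mathrm N0}.$$ In particular $\operatorname{div}\sigma_h=0$ in $\Omega_0$ and $\sigma_h\cdot n_\Omega=0$ on $\Gamma_{\mathrm N0}$. -/

import Mathlib

open MeasureTheory Filter Topology
open scoped ContDiff

noncomputable section

namespace FluxRec

/-- `ℝᵈ` with the Euclidean norm. -/
abbrev Vec (d : ℕ) := EuclideanSpace ℝ (Fin d)

/-! ### Weak derivatives, `H¹`, `H(div)` and boundary traces -/

section Sobolev

variable {d : ℕ}

/-- Smooth functions with compact support in `U`. -/
def IsTestFun (U : Set (Vec d)) (φ : Vec d → ℝ) : Prop :=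
  ContDiff ℝ ∞ φ ∧ HasCompactSupport φ ∧ tsupport φ ⊆ U

def IsWeakGrad (U : Set (Vec d)) (u : Vec d → ℝ) (G : Vec d → Vec d) : Prop :=
  ∀ φ, IsTestFun U φ → ∫ x in U, u x • gradient φ x = -∫ x in U, φ x • G x

def IsWeakDiv (U : Set (Vec d)) (σ : Vec d → Vec d) (g : Vec d → ℝ) : Prop :=
  ∀ φ, IsTestFun U φ → ∫ x in U, inner ℝ (σ x) (gradient φ x) = -∫ x in U, φ x * g x

/-- `u ∈ H¹(U)`. -/
def MemH1 (U : Set (Vec d)) (u : Vec d → ℝ) : Prop :=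
  MemLp u 2 (volume.restrict U) ∧
    ∃ G : Vec d → Vec d, MemLp G 2 (volume.restrict U) ∧ IsWeakGrad U u G

/-- `σ ∈ H(div, U)`. -/
def MemHdiv (U : Set (Vec d)) (σ : Vec d → Vec d) : Prop :=
  MemLp σ 2 (volume.restrict U) ∧
    ∃ g : Vec d → ℝ, MemLp g 2 (volume.restrict U) ∧ IsWeakDiv U σ g

open Classical in
/-- The square integrable weak gradient on `U`, unique up to null sets (`0` if there is none). -/
def wgrad (U : Set (Vec d)) (u : Vec d → ℝ) : Vec d → Vec d :=
  if h : ∃ G : Vec d → Vec d, MemLp G 2 (volume.restrict U) ∧ IsWeakGrad U u G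
  then h.choose else 0

open Classical in
/-- The square integrable weak divergence on `U`, unique up to null sets (`0` if there is none). -/
def wdiv (U : Set (Vec d)) (σ : Vec d → Vec d) : Vec d → ℝ :=
  if h : ∃ g : Vec d → ℝ, MemLp g 2 (volume.restrict U) ∧ IsWeakDiv U σ g
  then h.choose else 0

/-- The `(d-1)`-dimensional surface measure in `ℝᵈ`. -/
def surf : Measure (Vec d) := Measure.euclideanHausdorffMeasure (d - 1)

/-- `g` is the trace on `∂U` of `u ∈ H¹(U)`: there are functions `φₙ ∈ C_c^∞(ℝᵈ)` which converge
to `u` in `H¹(U)` and whose restrictions to `∂U` converge to `g` in `L²(∂U)`. -/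
def IsTrace (U : Set (Vec d)) (u g : Vec d → ℝ) : Prop :=
  MemH1 U u ∧ MemLp g 2 (surf.restrict (frontier U)) ∧
    ∃ φ : ℕ → Vec d → ℝ, (∀ n, IsTestFun Set.univ (φ n)) ∧
      Tendsto (fun n => eLpNorm (fun x => φ n x - u x) 2 (volume.restrict U)) atTop (𝓝 0) ∧
      Tendsto (fun n => eLpNorm (fun x => gradient (φ n) x - wgrad U u x) 2
        (volume.restrict U)) atTop (𝓝 0) ∧
      Tendsto (fun n => eLpNorm (fun x => φ n x - g x) 2 (surf.restrict (frontier U)))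
        atTop (𝓝 0)

open Classical in
/-- The trace of `u` on `∂U` (`0` if there is none). -/
def trace (U : Set (Vec d)) (u : Vec d → ℝ) : Vec d → ℝ :=
  if h : ∃ g, IsTrace U u g then h.choose else 0

/-- `g ∈ L²(∂U)` is the normal component `σ · n` on `∂U` of `σ ∈ H(div, U)`, in the usual sense of
Green's formula. -/
def IsNormalTrace (U : Set (Vec d)) (σ : Vec d → Vec d) (g : Vec d → ℝ) : Prop :=
  MemLp g 2 (surf.restrict (frontier U)) ∧
    ∀ v, IsTestFun Set.univ v →
      ∫ x in U, (inner ℝ (σ x) (gradient v x) + wdiv U σ x * v x) =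
        ∫ x in frontier U, g x * v x ∂surf

open Classical in
/-- The normal component of `σ` on `∂U` (`0` if it is not square integrable). -/
def normalTrace (U : Set (Vec d)) (σ : Vec d → Vec d) : Vec d → ℝ :=
  if h : ∃ g, IsNormalTrace U σ g then h.choose else 0

/-- `σ` has a square integrable normal component on `∂U`, and it vanishes on `Γ ⊆ ∂U`. -/
def NormalZeroOn (U : Set (Vec d)) (σ : Vec d → Vec d) (Γ : Set (Vec d)) : Prop :=
  ∃ g, IsNormalTrace U σ g ∧ ∀ᵐ x ∂(surf.restrict Γ), g x = 0

/-- The first order Raviart--Thomas space `[P₁]ᵈ + x P₁`. -/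
def IsRT1 (r : Vec d → Vec d) : Prop :=
  ∃ (p : Vec d →ᵃ[ℝ] Vec d) (q : Vec d →ᵃ[ℝ] ℝ), ∀ x, r x = p x + q x • x

/-- The closed simplex with the given vertices. -/
def hull (s : Finset (Vec d)) : Set (Vec d) := convexHull ℝ (s : Set (Vec d))

/-- The open simplex with the given vertices: the closed one without its proper faces. -/
def openHull (s : Finset (Vec d)) : Set (Vec d) :=
  {x | x ∈ hull s ∧ ∀ t, t ⊂ s → x ∉ hull t}

/-- The piecewise constant function with the value `f s` in the open simplex `s`, for `s ∈ S`. -/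
def piecewiseConst {M : Type*} [AddCommMonoid M] (S : Finset (Finset (Vec d)))
    (f : Finset (Vec d) → M) (x : Vec d) : M :=
  ∑ s ∈ S, (openHull s).indicator (fun _ => f s) x

end Sobolev

/-! ### Simplicial meshes -/

/-- A finite conforming simplicial mesh in `ℝᵈ` in which every simplex is a face of a
`d`-dimensional one. -/
structure Mesh (d : ℕ) extends Geometry.SimplicialComplex ℝ (Vec d) where
  finite_faces : faces.Finite
  pure : ∀ s ∈ faces, ∃ t ∈ faces, s ⊆ t ∧ t.card = d + 1

namespace Mesh

variable {d : ℕ} (T : Mesh d)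

/-- The elements of the mesh. -/
def cells : Finset (Finset (Vec d)) := T.finite_faces.toFinset.filter fun s => s.card = d + 1

/-- The facets (edges in the plane). -/
def facets : Finset (Finset (Vec d)) := T.finite_faces.toFinset.filter fun s => s.card = d

open Classical in
/-- The nodes of the mesh. -/
def nodes : Finset (Vec d) := T.finite_faces.toFinset.biUnion id

/-- The polytope that is triangulated by the mesh. -/
def domain : Set (Vec d) := interior T.space

open Classical in
/-- The facets on the boundary of the polytope. -/
def boundaryFacets : Finset (Finset (Vec d)) :=
  T.facets.filter fun F => hull F ⊆ frontier T.domain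

open Classical in
/-- The elements that contain the node `z`. -/
def cellsAt (z : Vec d) : Finset (Finset (Vec d)) := T.cells.filter fun K => z ∈ K

/-- The patch of `z`: the interior of the union of the elements that contain `z`. -/
def patch (z : Vec d) : Set (Vec d) := interior (⋃ K ∈ T.cellsAt z, hull K)

/-- The union of the facets on the boundary of the patch that do not contain `z`. -/
def outer (z : Vec d) : Set (Vec d) :=
  ⋃ F ∈ {F | F ∈ T.facets ∧ z ∉ F ∧ hull F ⊆ frontier (T.patch z)}, hull F

theorem affineSpan_cell {K : Finset (Vec d)} (hK : K ∈ T.cells) :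
    affineSpan ℝ (Set.range ((↑) : K → Vec d)) = ⊤ := by
  simp only [cells, Finset.mem_filter, Set.Finite.mem_toFinset] at hK
  rw [(T.indep hK.1).affineSpan_eq_top_iff_card_eq_finrank_add_one]
  simpa using hK.2

theorem mem_faces_of_mem_cells {K : Finset (Vec d)} (hK : K ∈ T.cells) : K ∈ T.faces := by
  simp only [cells, Finset.mem_filter, Set.Finite.mem_toFinset] at hK
  exact hK.1

/-- The vertices of an element as an affine basis; its coordinates are the barycentric ones. -/
def cellBasis {K : Finset (Vec d)} (hK : K ∈ T.cells) : AffineBasis K ℝ (Vec d) :=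
  ⟨((↑) : K → Vec d), T.indep (T.mem_faces_of_mem_cells hK), T.affineSpan_cell hK⟩

open Classical in
/-- The hat function of the node `z`: continuous on the polytope, affine on each element, one at `z`
and zero at all other nodes. On an element that contains `z` it is the barycentric coordinate of
`z`, on all other elements it is zero. -/
def hat (z x : Vec d) : ℝ :=
  if h : ∃ K, K ∈ T.cells ∧ x ∈ hull K then
    if hz : z ∈ h.choose then (T.cellBasis h.choose_spec.1).coord ⟨z, hz⟩ x else 0
  else 0

/-- The sum of the fields `σ z`, each of them given on the patch of `z` and extended by zero. -/
def sumPatches (σ : Vec d → Vec d → Vec d) (x : Vec d) : Vec d :=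
  ∑ z ∈ T.nodes, (T.patch z).indicator (σ z) x

end Mesh

/-! ### The eigenvalue problem -/

/-- The data of the shifted eigenvalue problem with coefficients that are piecewise constant with
respect to the mesh. The values at `K ∉ T.cells` and `F ∉ neumann` are irrelevant. -/
structure EigProblem {d : ℕ} (T : Mesh d) where
  /-- the facets that form the Neumann part of the boundary -/
  neumann : Finset (Finset (Vec d))
  neumann_subset : neumann ⊆ T.boundaryFacets
  A : Finset (Vec d) → Matrix (Fin d) (Fin d) ℝ
  c : Finset (Vec d) → ℝ
  β₁ : Finset (Vec d) → ℝ
  α : Finset (Vec d) → ℝ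
  β₂ : Finset (Vec d) → ℝ
  γ : ℝ
  A_posDef : ∀ K ∈ T.cells, (A K).PosDef
  c_nonneg : ∀ K ∈ T.cells, 0 ≤ c K
  β₁_nonneg : ∀ K ∈ T.cells, 0 ≤ β₁ K
  α_nonneg : ∀ F ∈ neumann, 0 ≤ α F
  β₂_nonneg : ∀ F ∈ neumann, 0 ≤ β₂ F
  β_pos : (∃ K ∈ T.cells, 0 < β₁ K) ∨ ∃ F ∈ neumann, 0 < β₂ F
  γ_pos : 0 < γ

namespace EigProblem

variable {d : ℕ} {T : Mesh d} (P : EigProblem T)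

/-! The coefficients as functions on the polytope and on the Neumann boundary. -/

def fA : Vec d → Matrix (Fin d) (Fin d) ℝ := piecewiseConst T.cells P.A
def fc : Vec d → ℝ := piecewiseConst T.cells P.c
def fβ₁ : Vec d → ℝ := piecewiseConst T.cells P.β₁
def fα : Vec d → ℝ := piecewiseConst P.neumann P.α
def fβ₂ : Vec d → ℝ := piecewiseConst P.neumann P.β₂

/-- The field `𝒜 w`. -/
def mulA (w : Vec d → Vec d) (x : Vec d) : Vec d := Matrix.toEuclideanLin (P.fA x) (w x)

/-- The field `𝒜⁻¹ w`. -/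
def mulAinv (w : Vec d → Vec d) (x : Vec d) : Vec d := Matrix.toEuclideanLin (P.fA x)⁻¹ (w x)

def ΓN : Set (Vec d) := ⋃ F ∈ P.neumann, hull F

def ΓD : Set (Vec d) := ⋃ F ∈ {F | F ∈ T.boundaryFacets ∧ F ∉ P.neumann}, hull F

/-- The part of the polytope that consists of the elements where both `c` and `β₁` vanish. -/
def Ω₀ : Set (Vec d) := T.domain ∩ ⋃ K ∈ {K | K ∈ T.cells ∧ P.c K = 0 ∧ P.β₁ K = 0}, hull K

def Ωplus : Set (Vec d) := T.domain \ P.Ω₀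

/-- The Neumann facets where both `α` and `β₂` vanish. -/
def neumann0 : Set (Finset (Vec d)) := {F | F ∈ P.neumann ∧ P.α F = 0 ∧ P.β₂ F = 0}

/-- The Neumann facets where `α` or `β₂` is positive. -/
def neumannPlus : Set (Finset (Vec d)) := {F | F ∈ P.neumann ∧ (0 < P.α F ∨ 0 < P.β₂ F)}

def ΓN0 : Set (Vec d) := ⋃ F ∈ P.neumann0, hull F

/-- The facets in `ΓN0` on the boundary of the patch of `z` that contain `z`. -/
def patchΓN0 (z : Vec d) : Set (Vec d) :=
  ⋃ F ∈ {F | F ∈ P.neumann0 ∧ z ∈ F ∧ hull F ⊆ frontier (T.patch z)}, hull F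

/-- The facets in `ΓN+` on the boundary of the patch of `z` that contain `z`. -/
def patchΓNplus (z : Vec d) : Set (Vec d) :=
  ⋃ F ∈ {F | F ∈ P.neumannPlus ∧ z ∈ F ∧ hull F ⊆ frontier (T.patch z)}, hull F

/-- `V`: the functions in `H¹(Ω)` that vanish on `ΓD`. -/
def MemV (v : Vec d → ℝ) : Prop :=
  ∃ g, IsTrace T.domain v g ∧ ∀ᵐ x ∂(surf.restrict P.ΓD), g x = 0

/-- The bilinear form `a`. -/
def formA (u v : Vec d → ℝ) : ℝ :=
  (∫ x in T.domain, inner ℝ (P.mulA (wgrad T.domain u) x) (wgrad T.domain v x)) +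
    (∫ x in T.domain, (P.fc x + P.γ * P.fβ₁ x) * u x * v x) +
    ∫ x in P.ΓN, (P.fα x + P.γ * P.fβ₂ x) * trace T.domain u x * trace T.domain v x ∂surf

/-- The bilinear form `b`. -/
def formB (u v : Vec d → ℝ) : ℝ :=
  (∫ x in T.domain, P.fβ₁ x * u x * v x) +
    ∫ x in P.ΓN, P.fβ₂ x * trace T.domain u x * trace T.domain v x ∂surf

/-- The lowest order conforming finite element space `V_h`. -/
def MemVh (v : Vec d → ℝ) : Prop :=
  P.MemV v ∧ ∀ K ∈ T.cells, ∃ p : Vec d →ᵃ[ℝ] ℝ, ∀ᵐ x ∂(volume.restrict (hull K)), v x = p x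

/-- `(Λ, u)` is a finite element eigenpair. -/
structure IsDiscreteEigenpair (Λ : ℝ) (u : Vec d → ℝ) : Prop where
  memVh : P.MemVh u
  ne_zero : ¬ ∀ᵐ x ∂(volume.restrict T.domain), u x = 0
  eq : ∀ v, P.MemVh v → P.formA u v = (Λ + P.γ) * P.formB u v

/-- The global flux space `W̃_h`. -/
structure MemWh (σ : Vec d → Vec d) : Prop where
  memHdiv : MemHdiv T.domain σ
  rt : ∀ K ∈ T.cells, ∃ r, IsRT1 r ∧ ∀ᵐ x ∂(volume.restrict (hull K)), σ x = r x
  normal : NormalZeroOn T.domain σ P.ΓN0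

/-- The local flux space `W̃_z`. -/
structure MemWz (z : Vec d) (σ : Vec d → Vec d) : Prop where
  memHdiv : MemHdiv (T.patch z) σ
  rt : ∀ K ∈ T.cellsAt z, ∃ r, IsRT1 r ∧ ∀ᵐ x ∂(volume.restrict (hull K)), σ x = r x
  normal : NormalZeroOn (T.patch z) σ (T.outer z ∪ P.patchΓN0 z)

/-- The local multiplier space `Q̃_z`. -/
structure MemQz (z : Vec d) (q : Vec d → ℝ) : Prop where
  memLp : MemLp q 2 (volume.restrict (T.patch z ∩ P.Ω₀))
  affine : ∀ K ∈ T.cellsAt z, hull K ⊆ closure P.Ω₀ →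
    ∃ p : Vec d →ᵃ[ℝ] ℝ, ∀ᵐ x ∂(volume.restrict (hull K)), q x = p x

/-- `(σ, q)` solves the local saddle point problem with penalty on the patch of `z`. -/
structure IsLocalSolution (Λ : ℝ) (u : Vec d → ℝ) (z : Vec d)
    (σ : Vec d → Vec d) (q : Vec d → ℝ) : Prop where
  memWz : P.MemWz z σ
  memQz : P.MemQz z q
  eq₁ : ∀ w, P.MemWz z w →
    (∫ x in T.patch z, inner ℝ (P.mulAinv σ x) (w x)) +
      (∫ x in T.patch z ∩ P.Ωplus,
        wdiv (T.patch z) σ x / (P.fc x + P.γ * P.fβ₁ x) * wdiv (T.patch z) w x) +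
      (∫ x in P.patchΓNplus z,
        normalTrace (T.patch z) σ x / (P.fα x + P.γ * P.fβ₂ x) *
          normalTrace (T.patch z) w x ∂surf) +
      (∫ x in T.patch z ∩ P.Ω₀, q x * wdiv (T.patch z) w x) =
    (∫ x in T.patch z, inner ℝ ((T.hat z x / (Λ + P.γ)) • wgrad T.domain u x) (w x)) -
      (∫ x in T.patch z ∩ P.Ωplus,
        (Λ * P.fβ₁ x - P.fc x) * T.hat z x * u x / ((P.fc x + P.γ * P.fβ₁ x) * (Λ + P.γ)) *
          wdiv (T.patch z) w x) +
      (∫ x in T.patch z ∩ P.Ωplus,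
        inner ℝ (P.mulA (gradient (T.hat z)) x) (wgrad T.domain u x) /
          ((P.fc x + P.γ * P.fβ₁ x) * (Λ + P.γ)) * wdiv (T.patch z) w x) +
      ∫ x in P.patchΓNplus z,
        (Λ * P.fβ₂ x - P.fα x) * T.hat z x * trace T.domain u x /
          ((P.fα x + P.γ * P.fβ₂ x) * (Λ + P.γ)) * normalTrace (T.patch z) w x ∂surf
  eq₂ : ∀ φ, P.MemQz z φ →
    ∫ x in T.patch z ∩ P.Ω₀, wdiv (T.patch z) σ x * φ x =
      ∫ x in T.patch z ∩ P.Ω₀,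
        inner ℝ (P.mulA (gradient (T.hat z)) x) (wgrad T.domain u x) / (Λ + P.γ) * φ x

/-- What the Lehmann--Goerisch theorem requires of a pair `(ũ, σ̃)`: `ũ ∈ V`, `σ̃ ∈ H(div, Ω)`,
`β₁ ũ + div σ̃ = 0` in `Ω₀` and `β₂ ũ - σ̃ · n = 0` on `ΓN0`. -/
structure LehmannGoerischAdmissible (u : Vec d → ℝ) (σ : Vec d → Vec d) : Prop where
  memV : P.MemV u
  memHdiv : MemHdiv T.domain σ
  div_eq : ∀ᵐ x ∂(volume.restrict P.Ω₀), P.fβ₁ x * u x + wdiv T.domain σ x = 0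
  normal_eq : ∃ g, IsNormalTrace T.domain σ g ∧
    ∀ᵐ x ∂(surf.restrict P.ΓN0), P.fβ₂ x * trace T.domain u x - g x = 0

end EigProblem

end FluxRec

end

noncomputable section

namespace FluxRec

/-! ### Geometry of simplices and meshes -/

section Hull

variable {d : ℕ}

/-! Gluing. Inside the polytope the boundary of a patch consists of facets opposite to `z`
(`frontier_patch_inter_domain_subset`), and there the normal component of `σ z` vanishes. Green's
formula for `σ z` on its patch, tested with a globally smooth function, therefore keeps only a
boundary term on `∂Ω`. Summing over the nodes (`exists_green_sumPatches`) gives Green's formula on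
`Ω` with divergence `sumDiv` and with the sum of the local normal traces. Compactly supported test
functions then give `H(div)`. A facet in `ΓN0` that lies on a patch boundary either contains `z` or
lies in `outer z`, so every local trace vanishes there.

Divergence. On an element `K` of `Ω₀` only the patches of the vertices of `K` contribute. Since the
field is in `RT₁`, its divergence on `K` is an affine function `Q` (`IsRT1.exists_isWeakDiv`), so
`Q` extended by zero is an admissible multiplier for each of these patches. Adding the constraints
`eq₂` tested with `Q` gives `∫_K Q² = 0`: the right-hand sides cancel because the hat functions of
the vertices sum to one on `K`, so their gradients sum to zero (`exists_gradient_hat`). The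
Lehmann–Goerisch conditions follow, as `β₁` and `β₂` vanish on `Ω₀` and `ΓN0`. -/

theorem isCompact_hull (s : Finset (Vec d)) : IsCompact (hull s) :=
  s.finite_toSet.isCompact_convexHull ℝ

theorem isClosed_hull (s : Finset (Vec d)) : IsClosed (hull s) := (isCompact_hull s).isClosed

theorem convex_hull (s : Finset (Vec d)) : Convex ℝ (hull s) := convex_convexHull ℝ _

theorem hull_mono {s t : Finset (Vec d)} (h : s ⊆ t) : hull s ⊆ hull t :=
  convexHull_mono (by exact_mod_cast h)

theorem mem_hull_of_mem {s : Finset (Vec d)} {z : Vec d} (hz : z ∈ s) : z ∈ hull s :=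
  subset_convexHull ℝ _ (by exact_mod_cast hz)

end Hull

namespace Mesh

variable {d : ℕ} (T : Mesh d)

theorem mem_cells {K : Finset (Vec d)} : K ∈ T.cells ↔ K ∈ T.faces ∧ K.card = d + 1 := by
  simp [cells]

theorem mem_facets {F : Finset (Vec d)} : F ∈ T.facets ↔ F ∈ T.faces ∧ F.card = d := by
  simp [facets]

theorem mem_cellsAt {K : Finset (Vec d)} {z : Vec d} :
    K ∈ T.cellsAt z ↔ K ∈ T.cells ∧ z ∈ K := by
  simp [cellsAt]

theorem mem_nodes_of_mem_cells {K : Finset (Vec d)} {z : Vec d} (hK : K ∈ T.cells) (hz : z ∈ K) :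
    z ∈ T.nodes := by
  simp only [nodes, Finset.mem_biUnion, Set.Finite.mem_toFinset, id]
  exact ⟨K, T.mem_faces_of_mem_cells hK, hz⟩

variable {T}

/-! ### Elements in barycentric coordinates, and conformity. -/

theorem mem_hull_iff {K : Finset (Vec d)} (hK : K ∈ T.cells) {x : Vec d} :
    x ∈ hull K ↔ ∀ i, 0 ≤ (T.cellBasis hK).coord i x := by
  have h := (T.cellBasis hK).convexHull_eq_nonneg_coord
  have h2 : Set.range (T.cellBasis hK) = (K : Set (Vec d)) := Subtype.range_coe
  rw [h2] at h
  rw [hull, h]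
  rfl

theorem mem_interior_hull_iff {K : Finset (Vec d)} (hK : K ∈ T.cells) {x : Vec d} :
    x ∈ interior (hull K) ↔ ∀ i, 0 < (T.cellBasis hK).coord i x := by
  have h := (T.cellBasis hK).interior_convexHull
  have h2 : Set.range (T.cellBasis hK) = (K : Set (Vec d)) := Subtype.range_coe
  rw [h2] at h
  rw [hull, h]
  rfl

theorem coord_eq_zero_of_mem_hull {K t : Finset (Vec d)} (hK : K ∈ T.cells) {v x : Vec d}
    (hv : v ∈ K) (htK : t ⊆ K) (hvt : v ∉ t) (hx : x ∈ hull t) :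
    (T.cellBasis hK).coord ⟨v, hv⟩ x = 0 := by
  have hc : Convex ℝ ((T.cellBasis hK).coord ⟨v, hv⟩ ⁻¹' {0}) :=
    (convex_singleton (0 : ℝ)).affine_preimage _
  refine convexHull_min (fun w hw => ?_) hc hx
  have hw' : w ∈ t := by exact_mod_cast hw
  have : (T.cellBasis hK) ⟨w, htK hw'⟩ = w := rfl
  simp only [Set.mem_preimage, Set.mem_singleton_iff]
  rw [← this]
  refine (T.cellBasis hK).coord_apply_ne fun h => hvt ?_
  rw [Subtype.mk.injEq] at h
  exact h ▸ hw'

open Classical in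
-- The vertex `v` has weight zero in the barycentric combination and can be dropped from it.
theorem mem_hull_erase {K : Finset (Vec d)} (hK : K ∈ T.cells) {v x : Vec d}
    (hv : v ∈ K) (hx : x ∈ hull K) (h0 : (T.cellBasis hK).coord ⟨v, hv⟩ x = 0) :
    x ∈ hull (K.erase v) := by
  have h1 := (T.cellBasis hK).linear_combination_coord_eq_self x
  have h2 := (T.cellBasis hK).sum_coord_apply_eq_one x
  rw [← Finset.sum_erase_add _ _ (Finset.mem_univ (⟨v, hv⟩ : K)), h0] at h1 h2
  simp only [add_zero, zero_smul] at h1 h2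
  rw [← h1]
  refine (convex_hull _).sum_mem (fun i _ => (mem_hull_iff hK).1 hx i) h2 fun i hi => ?_
  refine mem_hull_of_mem (Finset.mem_erase.2 ⟨fun h => ?_, i.2⟩)
  exact (Finset.mem_erase.1 hi).1 (Subtype.ext h)

open Classical in
theorem mem_hull_inter {s t : Finset (Vec d)} (hs : s ∈ T.faces) (ht : t ∈ T.faces) {x : Vec d}
    (hxs : x ∈ hull s) (hxt : x ∈ hull t) : x ∈ hull (s ∩ t) := by
  have := T.inter_subset_convexHull hs ht ⟨hxs, hxt⟩
  rwa [hull, Finset.coe_inter]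

/-- By conformity `x` lies in the common face `s ∩ t`, which would be a proper face of `t` if `t ⊆
s` failed. -/
theorem subset_of_mem_openHull {s t : Finset (Vec d)} (hs : s ∈ T.faces) (ht : t ∈ T.faces)
    {x : Vec d} (hxs : x ∈ hull s) (hxt : x ∈ openHull t) : t ⊆ s := by
  classical
  by_contra h
  refine hxt.2 (s ∩ t) ⟨Finset.inter_subset_right, fun h' => h (h'.trans Finset.inter_subset_left)⟩
    (mem_hull_inter hs ht hxs hxt.1)

theorem eq_of_mem_openHull {s t : Finset (Vec d)} (hs : s ∈ T.faces) (ht : t ∈ T.faces)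
    (hc : t.card = s.card) {x : Vec d} (hxs : x ∈ hull s) (hxt : x ∈ openHull t) : t = s :=
  Finset.eq_of_subset_of_card_le (subset_of_mem_openHull hs ht hxs hxt) hc.ge

/-- No other open simplex of the same dimension meets the closed simplex `s`, and on the relative
boundary of `s` all indicators vanish. Hence the value is zero at every point of `hull s`, with no
exceptional null set. -/
theorem piecewiseConst_eq_zero {M : Type*} [AddCommMonoid M] {S : Finset (Finset (Vec d))} {n : ℕ}
    (hS : ∀ s ∈ S, s ∈ T.faces ∧ s.card = n) {f : Finset (Vec d) → M} {s : Finset (Vec d)}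
    (hs : s ∈ S) (hf : f s = 0) {x : Vec d} (hx : x ∈ hull s) : piecewiseConst S f x = 0 := by
  refine Finset.sum_eq_zero fun t ht => ?_
  by_cases hxt : x ∈ openHull t
  · have := eq_of_mem_openHull (hS s hs).1 (hS t ht).1 ((hS t ht).2.trans (hS s hs).2.symm) hx hxt
    simp [this, hf]
  · simp [hxt]

/-- A vertex of `K` missing from `K'` would have coordinate zero at `x`, but all coordinates are
positive in the interior. -/
theorem eq_of_mem_interior_hull {K K' : Finset (Vec d)} (hK : K ∈ T.cells) (hK' : K' ∈ T.cells)
    {x : Vec d} (hx : x ∈ interior (hull K)) (hx' : x ∈ hull K') : K' = K := by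
  classical
  refine (Finset.eq_of_subset_of_card_le (s := K) (t := K') (fun v hv => ?_) ?_).symm
  · by_contra h
    have h1 := coord_eq_zero_of_mem_hull hK hv (t := K ∩ K') Finset.inter_subset_left
      (fun h' => h (Finset.mem_inter.1 h').2)
      (mem_hull_inter (T.mem_faces_of_mem_cells hK) (T.mem_faces_of_mem_cells hK')
        (interior_subset hx) hx')
    exact ((mem_interior_hull_iff hK).1 hx ⟨v, hv⟩).ne' h1
  · rw [(T.mem_cells.1 hK).2, (T.mem_cells.1 hK').2]

theorem ae_mem_interior_hull (K : Finset (Vec d)) :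
    ∀ᵐ x ∂(volume.restrict (hull K)), x ∈ interior (hull K) := by
  rw [ae_restrict_iff' (isClosed_hull K).measurableSet, ae_iff]
  refine measure_mono_null (fun x hx => ?_) ((convex_hull K).addHaar_frontier volume)
  simp only [Set.mem_ofPred_eq, Classical.not_imp] at hx
  exact ⟨subset_closure hx.1, hx.2⟩

theorem nonempty_interior_hull {K : Finset (Vec d)} (hK : K ∈ T.cells) :
    (interior (hull K)).Nonempty := by
  have h := (T.cellBasis hK).centroid_mem_interior_convexHull
  have h2 : Set.range (T.cellBasis hK) = (K : Set (Vec d)) := Subtype.range_coe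
  rw [h2] at h
  exact ⟨_, h⟩

theorem closure_interior_hull {K : Finset (Vec d)} (hK : K ∈ T.cells) :
    closure (interior (hull K)) = hull K := by
  rw [(convex_hull K).closure_interior_eq_closure_of_nonempty_interior (nonempty_interior_hull hK),
    (isClosed_hull K).closure_eq]

theorem mem_space_iff_cells {x : Vec d} : x ∈ T.space ↔ ∃ K ∈ T.cells, x ∈ hull K := by
  rw [Geometry.SimplicialComplex.mem_space_iff]
  constructor
  · rintro ⟨s, hs, hx⟩
    obtain ⟨t, ht, hst, hc⟩ := T.pure s hs
    exact ⟨t, T.mem_cells.2 ⟨ht, hc⟩, hull_mono hst hx⟩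
  · rintro ⟨K, hK, hx⟩
    exact ⟨K, T.mem_faces_of_mem_cells hK, hx⟩

/-! ### The polytope, the patches and their boundaries. -/

theorem isOpen_domain : IsOpen T.domain := isOpen_interior

theorem isOpen_patch (z : Vec d) : IsOpen (T.patch z) := isOpen_interior

theorem domain_subset_space : T.domain ⊆ T.space := interior_subset

theorem exists_cell_of_mem_domain {x : Vec d} (hx : x ∈ T.domain) : ∃ K ∈ T.cells, x ∈ hull K :=
  mem_space_iff_cells.1 (domain_subset_space hx)

theorem isClosed_iUnion_cellsAt (z : Vec d) : IsClosed (⋃ K ∈ T.cellsAt z, hull K) :=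
  isClosed_biUnion_finset fun K _ => isClosed_hull K

theorem exists_cellsAt_of_mem_closure_patch {z x : Vec d} (hx : x ∈ closure (T.patch z)) :
    ∃ K ∈ T.cellsAt z, x ∈ hull K := by
  have := closure_minimal interior_subset (T.isClosed_iUnion_cellsAt z) hx
  simpa using this

theorem patch_subset_domain (z : Vec d) : T.patch z ⊆ T.domain := by
  refine interior_mono fun x hx => ?_
  simp only [Set.mem_iUnion] at hx
  obtain ⟨K, hK, hx⟩ := hx
  exact mem_space_iff_cells.2 ⟨K, (T.mem_cellsAt.1 hK).1, hx⟩

theorem interior_hull_subset_patch {K : Finset (Vec d)} {z : Vec d} (hK : K ∈ T.cellsAt z) :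
    interior (hull K) ⊆ T.patch z :=
  interior_mono (Set.subset_biUnion_of_mem (u := fun K => hull K) hK)

theorem interior_hull_subset_domain {K : Finset (Vec d)} (hK : K ∈ T.cells) :
    interior (hull K) ⊆ T.domain :=
  interior_mono fun _ hx => mem_space_iff_cells.2 ⟨K, hK, hx⟩

theorem hull_subset_closure_patch {K : Finset (Vec d)} {z : Vec d} (hK : K ∈ T.cellsAt z) :
    hull K ⊆ closure (T.patch z) := by
  rw [← closure_interior_hull (T.mem_cellsAt.1 hK).1]
  exact closure_mono (interior_hull_subset_patch hK)

theorem mem_cellsAt_of_mem_patch {K : Finset (Vec d)} {x z : Vec d} (hK : K ∈ T.cells)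
    (hx : x ∈ interior (hull K)) (hxz : x ∈ T.patch z) : K ∈ T.cellsAt z := by
  obtain ⟨K', hK', hx'⟩ := exists_cellsAt_of_mem_closure_patch (subset_closure hxz)
  exact eq_of_mem_interior_hull hK (T.mem_cellsAt.1 hK').1 hx hx' ▸ hK'

theorem erase_mem_facets [DecidableEq (Vec d)] (hd : 1 ≤ d) {K : Finset (Vec d)}
    (hK : K ∈ T.cells) {v : Vec d} (hv : v ∈ K) : K.erase v ∈ T.facets := by
  have h := T.mem_cells.1 hK
  have hc : (K.erase v).card = d := by rw [Finset.card_erase_of_mem hv, h.2]; rfl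
  -- Faces of a simplicial complex are nonempty, hence the need for `1 ≤ d`.
  exact T.mem_facets.2 ⟨T.down_closed h.1 (Finset.erase_subset _ _)
    (Finset.card_pos.1 (by omega)), hc⟩

/-- A facet opposite to `z` in an element of the patch lies on the boundary of the patch. -/
theorem hull_erase_subset_frontier_patch [DecidableEq (Vec d)] {K : Finset (Vec d)} {z : Vec d}
    (hK : K ∈ T.cellsAt z) : hull (K.erase z) ⊆ frontier (T.patch z) := by
  intro y hy
  obtain ⟨hKc, hzK⟩ := T.mem_cellsAt.1 hK
  refine ⟨hull_subset_closure_patch hK (hull_mono (Finset.erase_subset _ _) hy), fun hi => ?_⟩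
  rw [(T.isOpen_patch z).interior_eq] at hi
  -- If `y` were inside the patch, it could be pushed slightly away from `z` and still lie in some
  -- element `K'` of the patch. The barycentric coordinate `b` of `z` in `K'` is nonnegative at the
  -- pushed point and one at `z`, so it is positive at `y`. Conformity forces it to vanish there.
  have hcont : Tendsto (fun ε : ℝ => AffineMap.lineMap z y (1 + ε)) (𝓝[>] 0) (𝓝 y) := by
    have : Continuous fun ε : ℝ => AffineMap.lineMap (k := ℝ) z y (1 + ε) := by fun_prop
    have h := this.tendsto 0
    simp only [add_zero, AffineMap.lineMap_apply_one] at h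
    exact h.mono_left nhdsWithin_le_nhds
  obtain ⟨ε, hε, hε0⟩ := ((hcont.eventually ((T.isOpen_patch z).mem_nhds hi)).and
    self_mem_nhdsWithin).exists
  have hε0 : 0 < ε := hε0
  obtain ⟨K', hK', hy'⟩ := exists_cellsAt_of_mem_closure_patch (subset_closure hε)
  obtain ⟨hKc', hzK'⟩ := T.mem_cellsAt.1 hK'
  set b := (T.cellBasis hKc').coord ⟨z, hzK'⟩
  have hbz : b z = 1 := (T.cellBasis hKc').coord_apply_eq ⟨z, hzK'⟩
  have h1 : 0 ≤ b (AffineMap.lineMap z y (1 + ε)) := (mem_hull_iff hKc').1 hy' _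
  rw [AffineMap.apply_lineMap, hbz, AffineMap.lineMap_apply_ring'] at h1
  have hb : 0 < b y := by
    by_contra hn
    push Not at hn
    nlinarith
  have hyK' : y ∈ hull K' := by
    have h2 : y = AffineMap.lineMap z (AffineMap.lineMap (k := ℝ) z y (1 + ε)) (1 + ε)⁻¹ := by
      rw [AffineMap.lineMap_lineMap_right, inv_mul_cancel₀ (by positivity),
        AffineMap.lineMap_apply_one]
    rw [h2]
    refine (convex_hull K').lineMap_mem (mem_hull_of_mem hzK') hy' ⟨by positivity, ?_⟩
    exact inv_le_one_of_one_le₀ (by linarith)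
  -- `y` lies in the common face of `K'` and `K.erase z`, which does not contain `z`.
  have h0 : b y = 0 := by
    refine coord_eq_zero_of_mem_hull hKc' hzK' (t := K' ∩ K.erase z) Finset.inter_subset_left
      (by simp) ?_
    have hne : (K.erase z).Nonempty := by
      by_contra hne
      rw [Finset.not_nonempty_iff_eq_empty] at hne
      simp [hull, hne] at hy
    convert mem_hull_inter (T.mem_faces_of_mem_cells hKc')
      (T.down_closed (T.mem_faces_of_mem_cells hKc) (Finset.erase_subset z K) hne) hyK' hy
  exact hb.ne' h0

theorem mem_outer_of_mem_hull_erase [DecidableEq (Vec d)] (hd : 1 ≤ d) {K : Finset (Vec d)}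
    {z x : Vec d} (hK : K ∈ T.cellsAt z) (hx : x ∈ hull (K.erase z)) : x ∈ T.outer z := by
  obtain ⟨hKc, hzK⟩ := T.mem_cellsAt.1 hK
  simp only [outer, Set.mem_iUnion]
  exact ⟨K.erase z, ⟨erase_mem_facets hd hKc hzK, Finset.notMem_erase _ _,
    hull_erase_subset_frontier_patch hK⟩, hx⟩

/-- Some element `K` of the patch contains `x`; by conformity `x` lies in `s ∩ K`, a part of the
facet of `K` opposite to `z`. -/
theorem mem_outer_of_mem_hull (hd : 1 ≤ d) {s : Finset (Vec d)} {z x : Vec d} (hs : s ∈ T.faces)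
    (hzs : z ∉ s) (hx : x ∈ hull s) (hxz : x ∈ closure (T.patch z)) : x ∈ T.outer z := by
  classical
  obtain ⟨K, hK, hxK⟩ := exists_cellsAt_of_mem_closure_patch hxz
  refine mem_outer_of_mem_hull_erase hd hK (hull_mono (fun v hv => ?_)
    (mem_hull_inter hs (T.mem_faces_of_mem_cells (T.mem_cellsAt.1 hK).1) hx hxK))
  obtain ⟨h1, h2⟩ := Finset.mem_inter.1 hv
  exact Finset.mem_erase.2 ⟨fun h => hzs (h ▸ h1), h2⟩

/-- Inside the polytope, the boundary of a patch consists of facets that do not contain `z`. -/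
theorem frontier_patch_inter_domain_subset (hd : 1 ≤ d) (z : Vec d) :
    frontier (T.patch z) ∩ T.domain ⊆ T.outer z := by
  classical
  rintro x ⟨hxf, hxd⟩
  by_contra hxo
  refine hxf.2 ?_
  rw [(T.isOpen_patch z).interior_eq]
  have hcell : ∀ K ∈ T.cells, x ∈ hull K → z ∈ K := fun K hK hxK => by
    by_contra hz
    exact hxo (mem_outer_of_mem_hull hd (T.mem_faces_of_mem_cells hK) hz hxK hxf.1)
  -- Removing the finitely many closed elements that miss `x` leaves a neighbourhood of `x` covered
  -- by elements through `x`, all of which have `z` as a vertex.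
  have hC : IsClosed (⋃ K ∈ T.cells.filter (fun K => x ∉ hull K), hull K) :=
    isClosed_biUnion_finset fun K _ => isClosed_hull K
  refine mem_interior.2 ⟨T.domain ∩ (⋃ K ∈ T.cells.filter (fun K => x ∉ hull K), hull K)ᶜ, ?_,
    isOpen_domain.inter hC.isOpen_compl, hxd, by simp⟩
  rintro y ⟨hyd, hyC⟩
  obtain ⟨K, hK, hyK⟩ := exists_cell_of_mem_domain hyd
  by_cases hxK : x ∈ hull K
  · simp only [Set.mem_iUnion]
    exact ⟨K, T.mem_cellsAt.2 ⟨hK, hcell K hK hxK⟩, hyK⟩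
  · refine absurd ?_ hyC
    simp only [Set.mem_iUnion]
    exact ⟨K, Finset.mem_filter.2 ⟨hK, hxK⟩, hyK⟩

theorem frontier_patch_diff_subset (hd : 1 ≤ d) (z : Vec d) :
    frontier (T.patch z) \ frontier T.domain ⊆ T.outer z := by
  rintro x ⟨hx, hxn⟩
  refine frontier_patch_inter_domain_subset hd z ⟨hx, ?_⟩
  by_contra h
  refine hxn ⟨closure_mono (patch_subset_domain z) hx.1, ?_⟩
  rwa [isOpen_domain.interior_eq]

theorem frontier_patch_subset (hd : 1 ≤ d) (z : Vec d) :
    frontier (T.patch z) ⊆ ⋃ F ∈ T.facets, hull F := by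
  classical
  intro x hx
  obtain ⟨K, hK, hxK⟩ := exists_cellsAt_of_mem_closure_patch hx.1
  have hKc := (T.mem_cellsAt.1 hK).1
  have hxi : x ∉ interior (hull K) := fun h => hx.2 (by
    rw [(T.isOpen_patch z).interior_eq]; exact interior_hull_subset_patch hK h)
  rw [mem_interior_hull_iff hKc] at hxi
  push Not at hxi
  obtain ⟨⟨v, hv⟩, h⟩ := hxi
  simp only [Set.mem_iUnion]
  exact ⟨K.erase v, erase_mem_facets hd hKc hv,
    mem_hull_erase hKc hv hxK (h.antisymm ((mem_hull_iff hKc).1 hxK _))⟩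

theorem hull_subset_frontier_patch {F : Finset (Vec d)} (hF : F ∈ T.boundaryFacets) {z : Vec d}
    (hz : z ∈ F) : hull F ⊆ frontier (T.patch z) := by
  simp only [boundaryFacets, Finset.mem_filter] at hF
  obtain ⟨t, ht, hFt, hc⟩ := T.pure F (T.mem_facets.1 hF.1).1
  intro x hx
  refine ⟨hull_subset_closure_patch (T.mem_cellsAt.2 ⟨T.mem_cells.2 ⟨ht, hc⟩, hFt hz⟩)
    (hull_mono hFt hx), fun hi => (hF.2 hx).2 ?_⟩
  rw [(T.isOpen_patch z).interior_eq] at hi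
  rw [isOpen_domain.interior_eq]
  exact patch_subset_domain z hi

end Mesh

/-! ### Surface measure of facets -/

section Surf

variable {d : ℕ}

/-- A facet is contained in a Lipschitz image of the unit cube of `ℝᵈ⁻¹`. The resulting finiteness
of the surface measure on patch boundaries makes test functions square integrable there, so that the
boundary integrals can be summed. -/
theorem surf_hull_lt_top {F : Finset (Vec d)} (hd : 1 ≤ d) (hF : F.card = d) :
    surf (hull F) < ⊤ := by
  classical
  obtain ⟨v, hv⟩ : F.Nonempty := Finset.card_pos.1 (by omega)
  set ι := {w // w ∈ F.erase v}
  have hι : Fintype.card ι = d - 1 := by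
    simp only [ι, Fintype.card_coe, Finset.card_erase_of_mem hv, hF]
  -- The cube is spanned by the edge vectors from the chosen vertex `v`; the weights of the other
  -- vertices are the parameters.
  let L : (ι → ℝ) →L[ℝ] Vec d := LinearMap.toContinuousLinearMap
    (∑ i : ι, (LinearMap.proj i : (ι → ℝ) →ₗ[ℝ] ℝ).smulRight ((i : Vec d) - v))
  have hL : ∀ t, L t = ∑ i : ι, t i • ((i : Vec d) - v) := fun t => by
    simp [L]
  let f : (ι → ℝ) → Vec d := fun t => v + L t
  have hf : LipschitzWith ‖L‖₊ f := by
    refine LipschitzWith.of_dist_le_mul fun a b => ?_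
    simpa [f] using L.lipschitz.dist_le_mul a b
  have hsub : hull F ⊆ f '' Set.Icc 0 1 := by
    intro x hx
    rw [hull, Finset.convexHull_eq] at hx
    obtain ⟨w, hw0, hw1, rfl⟩ := hx
    refine ⟨fun i => w i, ⟨fun i => hw0 _ (Finset.mem_of_mem_erase i.2), fun i => ?_⟩, ?_⟩
    · have := Finset.single_le_sum hw0 (Finset.mem_of_mem_erase i.2)
      simpa [hw1] using this
    · simp only [f, hL]
      rw [Finset.centerMass_eq_of_sum_1 _ _ hw1,
        Finset.sum_coe_sort (F.erase v) (fun i => w i • (i - v)),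
        Finset.sum_erase_eq_sub hv]
      simp only [sub_self, smul_zero, sub_zero, smul_sub, Finset.sum_sub_distrib,
        ← Finset.sum_smul, hw1, one_smul, id]
      abel
  refine (measure_mono hsub).trans_lt ?_
  rw [surf, Measure.euclideanHausdorffMeasure_def, Measure.smul_apply]
  have h1 : Measure.hausdorffMeasure ((d - 1 : ℕ) : ℝ) (f '' Set.Icc 0 1) < ⊤ := by
    refine (hf.hausdorffMeasure_image_le (by positivity) _).trans_lt ?_
    rw [← hι, hausdorffMeasure_pi_real]
    exact ENNReal.mul_lt_top (ENNReal.rpow_lt_top_of_nonneg (by positivity) (by simp))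
      isCompact_Icc.measure_lt_top
  rw [ENNReal.smul_def, smul_eq_mul]
  exact ENNReal.mul_lt_top ENNReal.coe_lt_top h1

theorem Mesh.surf_frontier_patch_lt_top (T : Mesh d) (hd : 1 ≤ d) (z : Vec d) :
    surf (frontier (T.patch z)) < ⊤ :=
  (measure_mono (Mesh.frontier_patch_subset hd z)).trans_lt
    (measure_biUnion_lt_top T.facets.finite_toSet
      fun _ hF => surf_hull_lt_top hd (T.mem_facets.1 hF).2)

end Surf

/-! ### Test functions and weak divergences -/

section WeakDiv

variable {d : ℕ} {U V : Set (Vec d)} {φ : Vec d → ℝ}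

theorem IsTestFun.mono (h : IsTestFun V φ) (hVU : V ⊆ U) : IsTestFun U φ :=
  ⟨h.1, h.2.1, h.2.2.trans hVU⟩

theorem IsTestFun.eq_zero (h : IsTestFun U φ) {x : Vec d} (hx : x ∉ U) : φ x = 0 :=
  image_eq_zero_of_notMem_tsupport fun h' => hx (h.2.2 h')

theorem IsTestFun.tsupport_gradient_subset : tsupport (gradient φ) ⊆ tsupport φ := by
  refine (closure_mono fun x hx => ?_).trans (tsupport_fderiv_subset ℝ (f := φ))
  intro h0
  exact hx (by simp [gradient, h0])

theorem IsTestFun.gradient_eq_zero (h : IsTestFun U φ) {x : Vec d} (hx : x ∉ U) :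
    gradient φ x = 0 :=
  image_eq_zero_of_notMem_tsupport fun h' => hx (h.2.2 (IsTestFun.tsupport_gradient_subset h'))

theorem IsTestFun.continuous_gradient (h : IsTestFun U φ) : Continuous (gradient φ) :=
  (InnerProductSpace.toDual ℝ (Vec d)).symm.continuous.comp
    (h.1.continuous_fderiv (by simp))

theorem IsTestFun.memLp (h : IsTestFun U φ) (μ : Measure (Vec d)) [IsFiniteMeasureOnCompacts μ] :
    MemLp φ 2 μ :=
  h.1.continuous.memLp_of_hasCompactSupport h.2.1

theorem IsTestFun.memLp_gradient (h : IsTestFun U φ) (μ : Measure (Vec d))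
    [IsFiniteMeasureOnCompacts μ] : MemLp (gradient φ) 2 μ :=
  h.continuous_gradient.memLp_of_hasCompactSupport
    (h.2.1.of_isClosed_subset (isClosed_tsupport _) IsTestFun.tsupport_gradient_subset)

theorem MemHdiv.memLp_wdiv {σ : Vec d → Vec d} (h : MemHdiv U σ) :
    MemLp (wdiv U σ) 2 (volume.restrict U) := by
  rw [wdiv, dif_pos h.2]
  exact h.2.choose_spec.1

theorem MemHdiv.isWeakDiv_wdiv {σ : Vec d → Vec d} (h : MemHdiv U σ) :
    IsWeakDiv U σ (wdiv U σ) := by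
  rw [wdiv, dif_pos h.2]
  exact h.2.choose_spec.2

theorem MemH1.memLp_wgrad {u : Vec d → ℝ} (h : MemH1 U u) :
    MemLp (wgrad U u) 2 (volume.restrict U) := by
  rw [wgrad, dif_pos h.2]
  exact h.2.choose_spec.1

/-- Weak divergences are local and unique. -/
theorem IsWeakDiv.ae_eq (hU : IsOpen U) (hV : IsOpen V) (hVU : V ⊆ U)
    {σ σ' : Vec d → Vec d} {g g' : Vec d → ℝ}
    (h : IsWeakDiv U σ g) (h' : IsWeakDiv V σ' g') (hσ : σ =ᵐ[volume.restrict V] σ')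
    (hg : MemLp g 2 (volume.restrict V)) (hg' : MemLp g' 2 (volume.restrict V)) :
    g =ᵐ[volume.restrict V] g' := by
  have hloc : LocallyIntegrableOn (fun x => g x - g' x) V :=
    locallyIntegrableOn_of_locallyIntegrable_restrict
      ((hg.sub hg').locallyIntegrable (by norm_num))
  have key := hV.ae_eq_zero_of_integral_contDiff_smul_eq_zero hloc fun φ h1 h2 h3 => ?_
  · refine (ae_restrict_iff' hV.measurableSet).2 ?_
    filter_upwards [key] with x hx hxV using sub_eq_zero.1 (hx hxV)
  · have hφ : IsTestFun V φ := ⟨h1, h2, h3⟩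
    have e1 := h φ (hφ.mono hVU)
    have e2 := h' φ hφ
    rw [setIntegral_eq_of_subset_of_forall_sdiff_eq_zero hU.measurableSet hVU (fun x hx => by
      rw [hφ.gradient_eq_zero hx.2, inner_zero_right]),
      setIntegral_eq_of_subset_of_forall_sdiff_eq_zero hU.measurableSet hVU (fun x hx => by
      rw [hφ.eq_zero hx.2, zero_mul])] at e1
    have e3 : ∫ x in V, inner ℝ (σ x) (gradient φ x) = ∫ x in V, inner ℝ (σ' x) (gradient φ x) :=
      integral_congr_ae (hσ.mono fun x hx => by simp only [hx])
    rw [← setIntegral_eq_integral_of_forall_compl_eq_zero (s := V) (fun x hx => by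
      rw [hφ.eq_zero hx, zero_smul])]
    have i1 : Integrable (fun x => φ x * g x) (volume.restrict V) :=
      (hφ.memLp _).integrable_mul hg
    have i2 : Integrable (fun x => φ x * g' x) (volume.restrict V) :=
      (hφ.memLp _).integrable_mul hg'
    simp only [smul_eq_mul, mul_sub]
    rw [integral_sub i1 i2]
    linarith

end WeakDiv

theorem integrable_inner_of_memLp {d : ℕ} {μ : Measure (Vec d)} {f g : Vec d → Vec d}
    (hf : MemLp f 2 μ) (hg : MemLp g 2 μ) : Integrable (fun x => inner ℝ (f x) (g x)) μ := by
  refine memLp_one_iff_integrable.1 (MemLp.of_bilin (fun a b => inner ℝ a b) 1 hf hg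
    (hf.1.inner hg.1) (Eventually.of_forall fun x => ?_))
  simpa using nnnorm_inner_le_nnnorm (𝕜 := ℝ) (f x) (g x)

theorem IsRT1.add {d : ℕ} {r s : Vec d → Vec d} (hr : IsRT1 r) (hs : IsRT1 s) : IsRT1 (r + s) := by
  obtain ⟨p, q, h⟩ := hr
  obtain ⟨p', q', h'⟩ := hs
  refine ⟨p + p', q + q', fun x => ?_⟩
  simp only [Pi.add_apply, h, h', AffineMap.coe_add, add_smul]
  abel

theorem isRT1_sum {d : ℕ} {ι : Type*} (s : Finset ι) {r : ι → Vec d → Vec d}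
    (h : ∀ i ∈ s, IsRT1 (r i)) : IsRT1 (∑ i ∈ s, r i) := by
  classical
  induction s using Finset.induction_on with
  | empty => exact ⟨0, 0, fun x => by simp⟩
  | insert a s ha ih =>
    rw [Finset.sum_insert ha]
    exact (h a (Finset.mem_insert_self a s)).add
      (ih fun i hi => h i (Finset.mem_insert_of_mem hi))

/-! ### The sum of the local fields -/

namespace Mesh

variable {d : ℕ} {T : Mesh d}

/-- In the interior of an element only the nodes of this element contribute. -/
theorem sum_indicator_patch {M : Type*} [AddCommMonoid M] {K : Finset (Vec d)} (hK : K ∈ T.cells)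
    {x : Vec d} (hx : x ∈ interior (hull K)) (f : Vec d → Vec d → M) :
    ∑ z ∈ T.nodes, (T.patch z).indicator (f z) x = ∑ z ∈ K, f z x := by
  rw [← Finset.sum_subset (s₁ := K) fun z hz => T.mem_nodes_of_mem_cells hK hz]
  · refine Finset.sum_congr rfl fun z hz => ?_
    rw [Set.indicator_of_mem (interior_hull_subset_patch (T.mem_cellsAt.2 ⟨hK, hz⟩) hx)]
  · intro z _ hzK
    rw [Set.indicator_of_notMem]
    exact fun h => hzK (T.mem_cellsAt.1 (mem_cellsAt_of_mem_patch hK hx h)).2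

/-- The sum of the divergences of the fields on the patches. -/
def sumDiv (T : Mesh d) (σ : Vec d → Vec d → Vec d) (x : Vec d) : ℝ :=
  ∑ z ∈ T.nodes, (T.patch z).indicator (wdiv (T.patch z) (σ z)) x

theorem memLp_sumDiv {σ : Vec d → Vec d → Vec d} (hσ : ∀ z ∈ T.nodes, MemHdiv (T.patch z) (σ z)) :
    MemLp (T.sumDiv σ) 2 (volume.restrict T.domain) :=
  memLp_finsetSum _ fun z hz =>
    ((memLp_indicator_iff_restrict (isOpen_patch z).measurableSet).2
      (hσ z hz).memLp_wdiv).restrict _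

theorem memLp_sumPatches {σ : Vec d → Vec d → Vec d}
    (hσ : ∀ z ∈ T.nodes, MemHdiv (T.patch z) (σ z)) :
    MemLp (T.sumPatches σ) 2 (volume.restrict T.domain) :=
  memLp_finsetSum _ fun z hz =>
    ((memLp_indicator_iff_restrict (isOpen_patch z).measurableSet).2 (hσ z hz).1).restrict _

end Mesh

/-! ### Gluing the local fields. -/

namespace EigProblem

open Mesh

variable {d : ℕ} {T : Mesh d} {P : EigProblem T} {σ : Vec d → Vec d → Vec d}

theorem measurableSet_ΓN0 : MeasurableSet P.ΓN0 :=
  MeasurableSet.biUnion ((P.neumann.finite_toSet.subset fun _ h => h.1).countable)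
    fun F _ => (isClosed_hull F).measurableSet

/-- Green's formula for the sum of the local fields. -/
theorem exists_green_sumPatches (hd : 1 ≤ d) (hσ : ∀ z ∈ T.nodes, P.MemWz z (σ z)) :
    ∃ g : Vec d → ℝ, MemLp g 2 (surf.restrict (frontier T.domain)) ∧
      (∀ v, IsTestFun Set.univ v →
        ∫ x in T.domain, (inner ℝ (T.sumPatches σ x) (gradient v x) + T.sumDiv σ x * v x) =
          ∫ x in frontier T.domain, g x * v x ∂surf) ∧
      ∀ᵐ x ∂(surf.restrict P.ΓN0), g x = 0 := by
  have hn := fun z hz => (hσ z hz).normal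
  choose! g hg h0 using hn
  have h0' : ∀ z ∈ T.nodes, ∀ᵐ x ∂surf, x ∈ T.outer z ∪ P.patchΓN0 z → g z x = 0 :=
    fun z hz => ae_imp_of_ae_restrict (h0 z hz)
  -- The global normal trace is the sum of the local ones, each extended by zero from its patch
  -- boundary.
  refine ⟨fun x => ∑ z ∈ T.nodes, (frontier (T.patch z)).indicator (g z) x, ?_, ?_, ?_⟩
  · exact memLp_finsetSum _ fun z hz =>
      ((memLp_indicator_iff_restrict isClosed_frontier.measurableSet).2 (hg z hz).1).restrict _
  · intro v hv
    have hL : ∀ x, inner ℝ (T.sumPatches σ x) (gradient v x) + T.sumDiv σ x * v x =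
        ∑ z ∈ T.nodes, (T.patch z).indicator
          (fun x => inner ℝ (σ z x) (gradient v x) + wdiv (T.patch z) (σ z) x * v x) x := fun x => by
      simp only [sumPatches, sumDiv, sum_inner, Finset.sum_mul, ← Finset.sum_add_distrib]
      refine Finset.sum_congr rfl fun z _ => ?_
      by_cases hx : x ∈ T.patch z <;> simp [hx]
    have hR : ∀ x, (∑ z ∈ T.nodes, (frontier (T.patch z)).indicator (g z) x) * v x =
        ∑ z ∈ T.nodes, (frontier (T.patch z)).indicator (fun x => g z x * v x) x := fun x => by
      rw [Finset.sum_mul]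
      refine Finset.sum_congr rfl fun z _ => ?_
      by_cases hx : x ∈ frontier (T.patch z) <;> simp [hx]
    simp only [hL, hR]
    rw [integral_finsetSum, integral_finsetSum]
    · refine Finset.sum_congr rfl fun z hz => ?_
      rw [setIntegral_indicator (isOpen_patch z).measurableSet,
        Set.inter_eq_self_of_subset_right (patch_subset_domain z), (hg z hz).2 v hv,
        setIntegral_indicator isClosed_frontier.measurableSet]
      -- The part of the patch boundary off `∂Ω` lies in `outer z`, where `g z` vanishes: no jump
      -- term remains inside `Ω`.
      refine setIntegral_eq_of_subset_of_ae_sdiff_eq_zero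
        isClosed_frontier.measurableSet.nullMeasurableSet Set.inter_subset_right ?_
      filter_upwards [h0' z hz] with x hx hxd
      rw [hx (Or.inl (frontier_patch_diff_subset hd z ⟨hxd.1, fun h => hxd.2 ⟨h, hxd.1⟩⟩)),
        zero_mul]
    · intro z hz
      have : IsFiniteMeasure (surf.restrict (frontier (T.patch z))) :=
        ⟨by simpa using T.surf_frontier_patch_lt_top hd z⟩
      refine Integrable.restrict ?_
      rw [integrable_indicator_iff isClosed_frontier.measurableSet]
      exact (hg z hz).1.integrable_mul (hv.memLp _)
    · intro z hz
      refine Integrable.restrict ?_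
      rw [integrable_indicator_iff (isOpen_patch z).measurableSet]
      exact (integrable_inner_of_memLp (hσ z hz).memHdiv.1 (hv.memLp_gradient _)).add
        ((hσ z hz).memHdiv.memLp_wdiv.integrable_mul (hv.memLp _))
  · rw [ae_restrict_iff' measurableSet_ΓN0]
    have h0'' : ∀ᵐ x ∂surf, ∀ z ∈ T.nodes, x ∈ T.outer z ∪ P.patchΓN0 z → g z x = 0 :=
      (Finset.eventually_all _).2 h0'
    filter_upwards [h0''] with x hx hxΓ
    refine Finset.sum_eq_zero fun z hz => ?_
    by_cases hxz : x ∈ frontier (T.patch z)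
    · rw [Set.indicator_of_mem hxz]
      refine hx z hz ?_
      simp only [ΓN0, Set.mem_iUnion] at hxΓ
      obtain ⟨F, hF, hxF⟩ := hxΓ
      have hFb := P.neumann_subset hF.1
      by_cases hzF : z ∈ F
      · refine Or.inr ?_
        simp only [patchΓN0, Set.mem_iUnion]
        exact ⟨F, ⟨hF, hzF, hull_subset_frontier_patch hFb hzF⟩, hxF⟩
      · refine Or.inl (mem_outer_of_mem_hull hd ?_ hzF hxF hxz.1)
        simp only [boundaryFacets, Finset.mem_filter] at hFb
        exact (T.mem_facets.1 hFb.1).1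
    · rw [Set.indicator_of_notMem hxz]

theorem isWeakDiv_sumPatches (hd : 1 ≤ d) (hσ : ∀ z ∈ T.nodes, P.MemWz z (σ z)) :
    IsWeakDiv T.domain (T.sumPatches σ) (T.sumDiv σ) := by
  obtain ⟨g, -, hg, -⟩ := exists_green_sumPatches hd hσ
  intro φ hφ
  have h := hg φ (hφ.mono (Set.subset_univ _))
  have h0 : ∫ x in frontier T.domain, g x * φ x ∂surf = 0 := by
    refine setIntegral_eq_zero_of_forall_eq_zero fun x hx => ?_
    rw [hφ.eq_zero, mul_zero]
    intro hxd
    exact hx.2 (by rwa [isOpen_domain.interior_eq])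
  have hm := memLp_sumPatches fun z hz => (hσ z hz).memHdiv
  have hm' := memLp_sumDiv fun z hz => (hσ z hz).memHdiv
  have i1 := integrable_inner_of_memLp hm (hφ.memLp_gradient _)
  have i2 : Integrable (fun x => T.sumDiv σ x * φ x) (volume.restrict T.domain) :=
    hm'.integrable_mul (hφ.memLp _)
  rw [h0, integral_add i1 i2] at h
  simp only [mul_comm (φ _)]
  linarith

theorem memHdiv_sumPatches (hd : 1 ≤ d) (hσ : ∀ z ∈ T.nodes, P.MemWz z (σ z)) :
    MemHdiv T.domain (T.sumPatches σ) :=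
  ⟨memLp_sumPatches fun z hz => (hσ z hz).memHdiv,
    T.sumDiv σ, memLp_sumDiv fun z hz => (hσ z hz).memHdiv, isWeakDiv_sumPatches hd hσ⟩

/-- `wdiv` is picked by choice, so uniqueness of weak divergences is what ties it to `sumDiv`. -/
theorem wdiv_sumPatches_ae_eq (hd : 1 ≤ d) (hσ : ∀ z ∈ T.nodes, P.MemWz z (σ z)) :
    wdiv T.domain (T.sumPatches σ) =ᵐ[volume.restrict T.domain] T.sumDiv σ :=
  (memHdiv_sumPatches hd hσ).isWeakDiv_wdiv.ae_eq isOpen_domain isOpen_domain subset_rfl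
    (isWeakDiv_sumPatches hd hσ) (ae_eq_refl _) (memHdiv_sumPatches hd hσ).memLp_wdiv
    (memLp_sumDiv fun z hz => (hσ z hz).memHdiv)

theorem normalZeroOn_sumPatches (hd : 1 ≤ d) (hσ : ∀ z ∈ T.nodes, P.MemWz z (σ z)) :
    NormalZeroOn T.domain (T.sumPatches σ) P.ΓN0 := by
  obtain ⟨g, hm, hg, h0⟩ := exists_green_sumPatches hd hσ
  refine ⟨g, ⟨hm, fun v hv => ?_⟩, h0⟩
  rw [← hg v hv]
  exact integral_congr_ae ((wdiv_sumPatches_ae_eq hd hσ).mono fun x hx => by simp only [hx])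

theorem memWh_sumPatches (hd : 1 ≤ d) (hσ : ∀ z ∈ T.nodes, P.MemWz z (σ z)) :
    P.MemWh (T.sumPatches σ) := by
  refine ⟨memHdiv_sumPatches hd hσ, fun K hK => ?_, normalZeroOn_sumPatches hd hσ⟩
  have h : ∀ z ∈ K, ∃ r, IsRT1 r ∧ ∀ᵐ x ∂(volume.restrict (hull K)), σ z x = r x := fun z hz =>
    (hσ z (T.mem_nodes_of_mem_cells hK hz)).rt K (T.mem_cellsAt.2 ⟨hK, hz⟩)
  choose! r hr hrσ using h
  refine ⟨∑ z ∈ K, r z, isRT1_sum K hr, ?_⟩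
  filter_upwards [ae_mem_interior_hull K, (Finset.eventually_all K).2 hrσ] with x hx hxr
  rw [sumPatches, sum_indicator_patch hK hx, Finset.sum_apply]
  exact Finset.sum_congr rfl hxr

end EigProblem

/-! ### Divergence of Raviart--Thomas functions -/

section RT

variable {d : ℕ}

theorem hasFDerivAt_affineMap {E F : Type*} [NormedAddCommGroup E]
    [NormedSpace ℝ E] [FiniteDimensional ℝ E] [NormedAddCommGroup F] [NormedSpace ℝ F]
    (p : E →ᵃ[ℝ] F) (x : E) : HasFDerivAt p (LinearMap.toContinuousLinearMap p.linear) x := by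
  have h : (p : E → F) = fun y => LinearMap.toContinuousLinearMap p.linear y + p 0 :=
    p.decomp
  rw [h]
  exact (ContinuousLinearMap.hasFDerivAt _).add_const _

theorem memLp_two_hull {f : Vec d → ℝ} (hf : Continuous f) (s : Finset (Vec d)) :
    MemLp f 2 (volume.restrict (hull s)) := by
  obtain ⟨C, hC⟩ := (isCompact_hull s).exists_bound_of_continuousOn hf.continuousOn
  have : IsFiniteMeasure (volume.restrict (hull s)) :=
    ⟨by simpa using (isCompact_hull s).measure_lt_top⟩
  exact MemLp.of_bound hf.aestronglyMeasurable C
    (ae_restrict_of_forall_mem (isClosed_hull s).measurableSet hC)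

theorem integral_mul_fderiv_of_contDiff {f φ : Vec d → ℝ} (hf : ContDiff ℝ 1 f)
    (hφ : ContDiff ℝ 1 φ) (hc : HasCompactSupport φ) (v : Vec d) :
    Integrable (fun x => f x * fderiv ℝ φ x v) ∧ Integrable (fun x => fderiv ℝ f x v * φ x) ∧
    ∫ x, f x * fderiv ℝ φ x v = -∫ x, fderiv ℝ f x v * φ x := by
  have c1 : Continuous fun x => fderiv ℝ φ x v :=
    (hφ.continuous_fderiv one_ne_zero).clm_apply continuous_const
  have c2 : Continuous fun x => fderiv ℝ f x v :=
    (hf.continuous_fderiv one_ne_zero).clm_apply continuous_const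
  have s1 : HasCompactSupport fun x => fderiv ℝ φ x v := hc.fderiv_apply ℝ v
  have i1 : Integrable (fun x => f x * fderiv ℝ φ x v) :=
    (hf.continuous.mul c1).integrable_of_hasCompactSupport s1.mul_left
  have i2 : Integrable (fun x => fderiv ℝ f x v * φ x) :=
    (c2.mul hφ.continuous).integrable_of_hasCompactSupport hc.mul_left
  refine ⟨i1, i2, integral_mul_fderiv_eq_neg_fderiv_mul_of_integrable i2 i1 ?_ ?_ ?_⟩
  · exact (hf.continuous.mul hφ.continuous).integrable_of_hasCompactSupport hc.mul_left
  · exact fun x _ => hf.differentiable one_ne_zero x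
  · exact fun x _ => hφ.differentiable one_ne_zero x

/-- The divergence of a first order Raviart--Thomas function is affine. -/
theorem IsRT1.exists_isWeakDiv {r : Vec d → Vec d} (hr : IsRT1 r) :
    ∃ Q : Vec d →ᵃ[ℝ] ℝ, ∀ U, IsWeakDiv U r Q := by
  obtain ⟨p, q, h⟩ := hr
  let e : Fin d → Vec d := fun i => EuclideanSpace.single i 1
  have hder : ∀ i x, HasFDerivAt (fun x => r x i)
      ((EuclideanSpace.proj i : Vec d →L[ℝ] ℝ) ∘L LinearMap.toContinuousLinearMap p.linear +
        (q x • (EuclideanSpace.proj i : Vec d →L[ℝ] ℝ) +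
          x i • LinearMap.toContinuousLinearMap q.linear)) x := fun i x => by
    have e1 : (fun x => r x i) = fun x => (EuclideanSpace.proj i : Vec d →L[ℝ] ℝ) (p x) +
        q x * (EuclideanSpace.proj i : Vec d →L[ℝ] ℝ) x := by
      ext x; simp [h]
    rw [e1]
    exact ((ContinuousLinearMap.hasFDerivAt _).comp x
      (hasFDerivAt_affineMap p x)).add
      ((hasFDerivAt_affineMap q x).mul (ContinuousLinearMap.hasFDerivAt _))
  have hC1 : ∀ i, ContDiff ℝ 1 fun x => r x i := fun i => by
    refine contDiff_one_iff_hasFDerivAt.2 ⟨_, ?_, hder i⟩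
    have := q.continuous_of_finiteDimensional
    fun_prop
  -- `div (p + q x) = div p + d q + ∇q · x`, and the last term is the linear part of `q` at `x`.
  let Q : Vec d →ᵃ[ℝ] ℝ := AffineMap.const ℝ _ (∑ i, p.linear (e i) i) +
    ((d : ℝ) • q + q.linear.toAffineMap)
  have hQ : ∀ x, Q x = ∑ i, fderiv ℝ (fun x => r x i) x (e i) := fun x => by
    have hx : q.linear x = ∑ i, x i * q.linear (e i) := by
      conv_lhs => rw [← (EuclideanSpace.basisFun (Fin d) ℝ).sum_repr x]
      simp [map_sum, e]
    have hx' : ∀ i, fderiv ℝ (fun x => r x i) x (e i) =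
        p.linear (e i) i + (q x + x i * q.linear (e i)) := fun i => by
      rw [(hder i x).fderiv]
      simp [e]
    simp [hx', Q, Finset.sum_add_distrib, hx]
  refine ⟨Q, fun U φ hφ => ?_⟩
  have hφ1 : ContDiff ℝ 1 φ := hφ.1.of_le (by exact_mod_cast le_top)
  -- Test functions vanish off `U`, so the integration by parts takes place on all of `ℝᵈ` and one
  -- `Q` serves every `U`.
  rw [setIntegral_eq_integral_of_forall_compl_eq_zero (fun x hx => by
      rw [hφ.gradient_eq_zero hx, inner_zero_right]),
    setIntegral_eq_integral_of_forall_compl_eq_zero (fun x hx => by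
      rw [hφ.eq_zero hx, zero_mul])]
  have hI := fun i => integral_mul_fderiv_of_contDiff (hC1 i) hφ1 hφ.2.1 (e i)
  have e1 : ∀ x, inner ℝ (r x) (gradient φ x) = ∑ i, r x i * fderiv ℝ φ x (e i) := fun x => by
    rw [inner_gradient_right]
    conv_lhs => rw [← (EuclideanSpace.basisFun (Fin d) ℝ).sum_repr (r x)]
    simp [map_sum, e]
  have e2 : ∀ x, φ x * Q x = ∑ i, fderiv ℝ (fun x => r x i) x (e i) * φ x := fun x => by
    rw [hQ, mul_comm, Finset.sum_mul]
  simp only [e1, e2]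
  rw [integral_finsetSum _ fun i _ => (hI i).1, integral_finsetSum _ fun i _ => (hI i).2.1,
    ← Finset.sum_neg_distrib]
  exact Finset.sum_congr rfl fun i _ => (hI i).2.2

end RT

/-! ### The divergence constraint -/

namespace Mesh

variable {d : ℕ} {T : Mesh d} {K : Finset (Vec d)}

theorem hat_eq_coord (hK : K ∈ T.cells) {z x : Vec d} (hz : z ∈ K)
    (hx : x ∈ interior (hull K)) : T.hat z x = (T.cellBasis hK).coord ⟨z, hz⟩ x := by
  have h : ∃ K, K ∈ T.cells ∧ x ∈ hull K := ⟨K, hK, interior_subset hx⟩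
  rw [hat, dif_pos h]
  -- `hat` uses a chosen element containing `x`, which must be `K`. Generalizing over it allows
  -- substitution despite the dependent membership proofs.
  have key : ∀ K' (hK' : K' ∈ T.cells), K' = K →
      (if hz : z ∈ K' then (T.cellBasis hK').coord ⟨z, hz⟩ x else 0) =
        (T.cellBasis hK).coord ⟨z, hz⟩ x := by
    rintro _ _ rfl
    simp [hz]
  exact key _ h.choose_spec.1 (eq_of_mem_interior_hull hK h.choose_spec.1 hx h.choose_spec.2)

/-- The gradients of the hat functions are constant on an element, and their sum vanishes. -/
theorem exists_gradient_hat (hK : K ∈ T.cells) :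
    ∃ a : Vec d → Vec d, (∀ z ∈ K, ∀ x ∈ interior (hull K), gradient (T.hat z) x = a z) ∧
      ∑ z ∈ K, a z = 0 := by
  classical
  let D := (InnerProductSpace.toDual ℝ (Vec d)).symm
  let ℓ : K → Vec d →ₗ[ℝ] ℝ := fun z => ((T.cellBasis hK).coord z).linear
  refine ⟨fun z => if hz : z ∈ K then D (LinearMap.toContinuousLinearMap (ℓ ⟨z, hz⟩)) else 0,
    fun z hz x hx => ?_, ?_⟩
  · have h : T.hat z =ᶠ[𝓝 x] (T.cellBasis hK).coord ⟨z, hz⟩ := by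
      filter_upwards [isOpen_interior.mem_nhds hx] with y hy using hat_eq_coord hK hz hy
    rw [h.gradient_eq, gradient,
      (hasFDerivAt_affineMap ((T.cellBasis hK).coord ⟨z, hz⟩) x).fderiv]
    simp only [dif_pos hz, D, ℓ]
  · rw [← Finset.sum_coe_sort K]
    simp only [Finset.coe_mem, dite_true, Subtype.coe_eta]
    rw [← map_sum]
    -- The coordinates sum to one both at `y` and at the origin; subtract.
    have h0 : ∑ z, LinearMap.toContinuousLinearMap (ℓ z) = 0 := by
      ext y
      have h1 := (T.cellBasis hK).sum_coord_apply_eq_one y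
      have h2 := (T.cellBasis hK).sum_coord_apply_eq_one 0
      have h3 : ∀ z, ℓ z y = (T.cellBasis hK).coord z y - (T.cellBasis hK).coord z 0 := fun z => by
        have := ((T.cellBasis hK).coord z).linearMap_vsub y 0
        simpa [ℓ] using this
      simp only [Finset.univ_eq_attach] at h1 h2
      simp [h3, h1, h2]
    rw [h0, map_zero]

theorem mem_openHull_of_mem_interior (hK : K ∈ T.cells) {x : Vec d}
    (hx : x ∈ interior (hull K)) : x ∈ openHull K := by
  refine ⟨interior_subset hx, fun t ht hxt => ?_⟩
  obtain ⟨v, hv, hvt⟩ := Finset.exists_of_ssubset ht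
  exact ((mem_interior_hull_iff hK).1 hx ⟨v, hv⟩).ne'
    (coord_eq_zero_of_mem_hull hK hv ht.1 hvt hxt)

theorem piecewiseConst_cells {M : Type*} [AddCommMonoid M] (f : Finset (Vec d) → M)
    (hK : K ∈ T.cells) {x : Vec d} (hx : x ∈ interior (hull K)) :
    piecewiseConst T.cells f x = f K := by
  rw [piecewiseConst, Finset.sum_eq_single_of_mem K hK,
    Set.indicator_of_mem (mem_openHull_of_mem_interior hK hx)]
  intro t ht htK
  exact Set.indicator_of_notMem (fun h => htK (eq_of_mem_interior_hull hK ht hx h.1)) _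

end Mesh

/-! ### The local constraints tested on a single element. -/

namespace EigProblem

open Mesh

variable {d : ℕ} {T : Mesh d} {P : EigProblem T} {K : Finset (Vec d)}

theorem measurableSet_Ω₀ : MeasurableSet P.Ω₀ :=
  isOpen_domain.measurableSet.inter <|
    MeasurableSet.biUnion ((T.cells.finite_toSet.subset fun _ h => h.1).countable)
      fun F _ => (isClosed_hull F).measurableSet

theorem fβ₁_eq_zero {x : Vec d} (hx : x ∈ P.Ω₀) : P.fβ₁ x = 0 := by
  obtain ⟨-, hx⟩ := hx
  simp only [Set.mem_iUnion] at hx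
  obtain ⟨K, hK, hx⟩ := hx
  exact piecewiseConst_eq_zero (fun s hs => T.mem_cells.1 hs) hK.1 hK.2.2 hx

theorem fβ₂_eq_zero {x : Vec d} (hx : x ∈ P.ΓN0) : P.fβ₂ x = 0 := by
  simp only [ΓN0, Set.mem_iUnion] at hx
  obtain ⟨F, hF, hx⟩ := hx
  refine piecewiseConst_eq_zero (T := T) (n := d) (fun s hs => ?_) hF.1 hF.2.2 hx
  have h := P.neumann_subset hs
  simp only [boundaryFacets, Finset.mem_filter] at h
  exact T.mem_facets.1 h.1

/-- An affine function on one element, extended by zero, is a local multiplier. -/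
theorem memQz_indicator (hK : K ∈ T.cells) (z : Vec d) (p : Vec d →ᵃ[ℝ] ℝ) :
    P.MemQz z ((hull K).indicator p) := by
  refine ⟨MemLp.restrict _ ?_, fun K' hK' _ => ?_⟩
  · rw [memLp_indicator_iff_restrict (isClosed_hull K).measurableSet]
    exact memLp_two_hull p.continuous_of_finiteDimensional K
  · by_cases h : K' = K
    · subst h
      exact ⟨p, ae_restrict_of_forall_mem (isClosed_hull _).measurableSet fun x hx =>
        Set.indicator_of_mem hx _⟩
    · refine ⟨0, (ae_mem_interior_hull K').mono fun x hx => ?_⟩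
      rw [Set.indicator_of_notMem]
      · rfl
      · exact fun hxK => h (eq_of_mem_interior_hull (T.mem_cellsAt.1 hK').1 hK hx hxK).symm

/-- Localizes both sides of `eq₂` to `K` when the multiplier is supported there; the boundary of `K`
is a null set. -/
theorem setIntegral_patch_inter_Ω₀_indicator (hK : K ∈ T.cells) (hc : P.c K = 0)
    (hβ : P.β₁ K = 0) {z : Vec d} (hz : z ∈ K) (f g : Vec d → ℝ) :
    ∫ x in T.patch z ∩ P.Ω₀, f x * (hull K).indicator g x =
      ∫ x in interior (hull K), f x * g x := by
  have hm : MeasurableSet (T.patch z ∩ P.Ω₀) :=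
    (isOpen_patch z).measurableSet.inter measurableSet_Ω₀
  have hsub : interior (hull K) ⊆ T.patch z ∩ P.Ω₀ := fun x hx =>
    ⟨interior_hull_subset_patch (T.mem_cellsAt.2 ⟨hK, hz⟩) hx,
      interior_hull_subset_domain hK hx, by
        simp only [Set.mem_iUnion]
        exact ⟨K, ⟨hK, hc, hβ⟩, interior_subset hx⟩⟩
  rw [setIntegral_eq_of_subset_of_ae_sdiff_eq_zero hm.nullMeasurableSet hsub]
  · refine setIntegral_congr_fun isOpen_interior.measurableSet fun x hx => ?_
    simp only [Set.indicator_of_mem (interior_subset hx)]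
  · have h := (ae_restrict_iff' (isClosed_hull K).measurableSet).1 (ae_mem_interior_hull K)
    filter_upwards [h] with x hx hxd
    rw [Set.indicator_of_notMem (fun h' => hxd.2 (hx h')), mul_zero]

/-- The reconstructed flux is divergence free on the elements in `Ω₀`. -/
theorem wdiv_sumPatches_ae_eq_zero_hull (hd : 1 ≤ d) {Λ : ℝ} {u : Vec d → ℝ}
    (hu : MemH1 T.domain u) {σ : Vec d → Vec d → Vec d} {q : Vec d → Vec d → ℝ}
    (hσ : ∀ z ∈ T.nodes, P.IsLocalSolution Λ u z (σ z) (q z))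
    (hK : K ∈ T.cells) (hc : P.c K = 0) (hβ : P.β₁ K = 0) :
    ∀ᵐ x ∂(volume.restrict (hull K)), wdiv T.domain (T.sumPatches σ) x = 0 := by
  have hW := fun z hz => (hσ z hz).memWz
  have hKd := interior_hull_subset_domain hK
  have hKi := isOpen_interior (s := hull K)
  have hres : volume.restrict (interior (hull K)) = volume.restrict (hull K) :=
    Measure.restrict_congr_set (interior_ae_eq_of_null_frontier
      ((convex_hull K).addHaar_frontier volume))
  obtain ⟨r, hr, hσr⟩ := (memWh_sumPatches hd hW).rt K hK
  obtain ⟨Q, hQ⟩ := hr.exists_isWeakDiv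
  have hQc : Continuous Q := Q.continuous_of_finiteDimensional
  have hQm : MemLp Q 2 (volume.restrict (interior (hull K))) := by
    rw [hres]
    exact memLp_two_hull hQc K
  have hD : T.sumDiv σ =ᵐ[volume.restrict (interior (hull K))] Q :=
    (isWeakDiv_sumPatches hd hW).ae_eq isOpen_domain hKi hKd (hQ _) (hres ▸ hσr)
      ((memLp_sumDiv fun z hz => (hW z hz).memHdiv).mono_measure (Measure.restrict_mono hKd le_rfl))
      hQm
  have hD' : ∀ᵐ x ∂volume.restrict (interior (hull K)),
      Q x = ∑ z ∈ K, wdiv (T.patch z) (σ z) x := by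
    filter_upwards [hD, ae_restrict_mem hKi.measurableSet] with x hx hxK
    rw [← hx, sumDiv, sum_indicator_patch hK hxK]
  obtain ⟨a, ha, ha0⟩ := exists_gradient_hat hK
  let B := Matrix.toEuclideanLin (P.A K)
  have hf : ∀ z ∈ K, ∫ x in interior (hull K), wdiv (T.patch z) (σ z) x * Q x =
      ∫ x in interior (hull K), inner ℝ (B (a z)) (wgrad T.domain u x) / (Λ + P.γ) * Q x := by
    intro z hz
    -- The multiplier is the divergence `Q` of the total field on `K`, the same for all vertices
    -- `z`.
    have h := (hσ z (T.mem_nodes_of_mem_cells hK hz)).eq₂ _ (memQz_indicator hK z Q)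
    rw [setIntegral_patch_inter_Ω₀_indicator hK hc hβ hz,
      setIntegral_patch_inter_Ω₀_indicator hK hc hβ hz] at h
    rw [h]
    refine setIntegral_congr_fun hKi.measurableSet fun x hx => ?_
    simp only [mulA, fA, piecewiseConst_cells P.A hK hx, ha z hz x hx, B]
  have hint : ∫ x in interior (hull K), Q x * Q x = 0 := by
    have e1 : ∫ x in interior (hull K), Q x * Q x =
        ∫ x in interior (hull K), ∑ z ∈ K, wdiv (T.patch z) (σ z) x * Q x :=
      integral_congr_ae (hD'.mono fun x hx => by
        simp only
        rw [← Finset.sum_mul, ← hx])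
    rw [e1, integral_finsetSum, Finset.sum_congr rfl hf, ← integral_finsetSum]
    -- By linearity the summed integrand contains `B (∑ a z)`, which is zero.
    · refine integral_eq_zero_of_ae (Eventually.of_forall fun x => ?_)
      simp only
      rw [← Finset.sum_mul, ← Finset.sum_div, ← sum_inner, ← map_sum, ha0]
      simp
    · intro z hz
      have h1 : MemLp (wgrad T.domain u) 2 (volume.restrict (interior (hull K))) :=
        hu.memLp_wgrad.mono_measure (Measure.restrict_mono hKd le_rfl)
      have h2 := (h1.const_inner (𝕜 := ℝ) (B (a z))).integrable_mul hQm
      simp only [div_mul_eq_mul_div]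
      exact h2.div_const _
    · intro z hz
      exact ((hW z (T.mem_nodes_of_mem_cells hK hz)).memHdiv.memLp_wdiv.mono_measure
        (Measure.restrict_mono (interior_hull_subset_patch (T.mem_cellsAt.2 ⟨hK, hz⟩))
          le_rfl)).integrable_mul hQm
  rw [integral_eq_zero_iff_of_nonneg (fun x => mul_self_nonneg _) (hQm.integrable_mul hQm)] at hint
  have hwd := ae_restrict_of_ae_restrict_of_subset hKd (wdiv_sumPatches_ae_eq hd hW)
  rw [← hres]
  filter_upwards [hint, hD, hwd] with x h1 h2 h3
  rw [h3, h2]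
  exact mul_self_eq_zero.1 h1

theorem wdiv_sumPatches_ae_eq_zero (hd : 1 ≤ d) {Λ : ℝ} {u : Vec d → ℝ}
    (hu : MemH1 T.domain u) {σ : Vec d → Vec d → Vec d} {q : Vec d → Vec d → ℝ}
    (hσ : ∀ z ∈ T.nodes, P.IsLocalSolution Λ u z (σ z) (q z)) :
    ∀ᵐ x ∂(volume.restrict P.Ω₀), wdiv T.domain (T.sumPatches σ) x = 0 := by
  refine ae_restrict_of_ae_restrict_of_subset Set.inter_subset_right ?_
  rw [ae_restrict_biUnion_iff _ (T.cells.finite_toSet.subset fun _ h => h.1).countable]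
  exact fun K hK => wdiv_sumPatches_ae_eq_zero_hull hd hu hσ hK.1 hK.2.1 hK.2.2

end EigProblem

end FluxRec

end

/-! ### Conclusion. -/

theorem mainTheorem3 {d : ℕ} (hd : 1 ≤ d) (T : FluxRec.Mesh d) (P : FluxRec.EigProblem T)
    (Λ : ℝ) (u : FluxRec.Vec d → ℝ) (hu : P.IsDiscreteEigenpair Λ u)
    (σ : FluxRec.Vec d → FluxRec.Vec d → FluxRec.Vec d) (q : FluxRec.Vec d → FluxRec.Vec d → ℝ)
    (hσ : ∀ z ∈ T.nodes, P.IsLocalSolution Λ u z (σ z) (q z)) :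
    P.MemWh (T.sumPatches σ) ∧
      P.LehmannGoerischAdmissible u (T.sumPatches σ) ∧
      (∀ᵐ x ∂(MeasureTheory.volume.restrict P.Ω₀),
        FluxRec.wdiv T.domain (T.sumPatches σ) x = 0) ∧
      FluxRec.NormalZeroOn T.domain (T.sumPatches σ) P.ΓN0 := by
  open FluxRec EigProblem in
  have hW := memWh_sumPatches hd fun z hz => (hσ z hz).memWz
  have hV := hu.memVh.1
  have hH1 : MemH1 T.domain u := by
    obtain ⟨g, hg, -⟩ := hV
    exact hg.1
  have hdiv := wdiv_sumPatches_ae_eq_zero hd hH1 hσ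
  refine ⟨hW, ⟨hV, hW.memHdiv, ?_, ?_⟩, hdiv, hW.normal⟩
  · filter_upwards [hdiv, ae_restrict_mem measurableSet_Ω₀] with x h1 h2
    rw [fβ₁_eq_zero h2, h1, zero_mul, add_zero]
  · obtain ⟨g, hg, h0⟩ := hW.normal
    refine ⟨g, hg, ?_⟩
    filter_upwards [h0, ae_restrict_mem measurableSet_ΓN0] with x h1 h2
    rw [fβ₂_eq_zero h2, h1, zero_mul, sub_zero]
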